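/- For rational numbers written in lowest terms with positive denominators, let $$\frac{a}{b}\oplus\frac{c}{d}=\frac{a+c}{b+d},\qquad \frac{p_1}{q_1}*\frac{p_2}{q_2}=\frac{p_1q_1+p_2q_2}{q_1^2+q_2^2}$$ be the Farey mediant and the Springborn mediant. Let $\mu:\mathbb Q\cap[0,1]\to\mathbb Q$ be the Springborn function, i.e. the function defined recursively along the Farey tree by $\mu(0)=0$, $\mu(1)=\tfrac12$ and $$\mu\left(\frac ab\oplus\frac cd\right)=\mu\left(\frac ab\right)*\mu\left(\frac cd\right)\qquad\text{whenever } |ad-bc|=1 .$$ Extend it to real $x\in[0,1]$ by $\mu(x)=\sup\{\mu(r): r\in\mathbb Q\cap[0,1],\ r\le x\}$. Then this does extend $\mu$ from $\mathbb Q\cap[0,1]$ to a monotonically increasing (nondecreasing) function on $[0,1]$, and for almost every $x\in[0,1]$ (with respect to Lebesgue measure) the extended function $\mu$ is differentiable at $x$ with $$\mu'(x)=0 .$$ -/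

import Mathlib

/-- The Farey mediant `(a₁ + a₂) / (b₁ + b₂)` of the reduced fractions `a₁ / b₁` and `a₂ / b₂`. -/
def fareyMediant (x y : ℚ) : ℚ :=
  ((x.num + y.num : ℤ) : ℚ) / ((x.den + y.den : ℤ) : ℚ)

/-- The Springborn mediant `(p₁ q₁ + p₂ q₂) / (q₁² + q₂²)` of the reduced fractions
`p₁ / q₁` and `p₂ / q₂`. -/
def springbornMediant (x y : ℚ) : ℚ :=
  ((x.num * x.den + y.num * y.den : ℤ) : ℚ) / ((x.den ^ 2 + y.den ^ 2 : ℤ) : ℚ)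

/-- Simultaneous descent in the Farey tree and in the Markov fraction tree.  The Farey
neighbours `a < b` carry the Markov fractions `p` and `q`; the point `x` is looked for strictly
between `a` and `b`.  The first argument bounds the number of steps (at most the denominator of
`x` many are needed, see `springbornRat_fareyMediant`). -/
def springbornDescent : ℕ → ℚ → ℚ → ℚ → ℚ → ℚ → ℚ
  | 0, _, _, _, _, _ => 0
  | n + 1, a, b, p, q, x =>
    if x = fareyMediant a b then springbornMediant p q
    else if x < fareyMediant a b then
      springbornDescent n a (fareyMediant a b) p (springbornMediant p q) x
    else
      springbornDescent n (fareyMediant a b) b (springbornMediant p q) q x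

/-- The Springborn function on the rational points of `[0, 1]`: it sends `0` to `0`, `1` to `1 / 2`
and Farey mediants of neighbours to Springborn mediants. -/
def springbornRat (x : ℚ) : ℚ :=
  if x = 0 then 0 else if x = 1 then 1 / 2 else springbornDescent x.den 0 1 0 (1 / 2) x

theorem fareyMediant_num_den {a b : ℚ} (h : b.num * a.den - a.num * b.den = 1) :
    (fareyMediant a b).num = a.num + b.num ∧ ((fareyMediant a b).den : ℤ) = a.den + b.den := by
  have hpos : (0 : ℤ) < a.den + b.den := by
    have := a.den_pos
    have := b.den_pos
    omega
  have hc : (a.num + b.num).natAbs.Coprime ((a.den : ℤ) + b.den).natAbs :=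
    Int.isCoprime_iff_gcd_eq_one.mp ⟨a.den, -a.num, by linear_combination h⟩
  exact ⟨Rat.num_div_eq_of_coprime hpos hc, Rat.den_div_eq_of_coprime hpos hc⟩

theorem fareyMediant_between {a b : ℚ} (h : b.num * a.den - a.num * b.den = 1) :
    a < fareyMediant a b ∧ fareyMediant a b < b ∧
    (fareyMediant a b).num * a.den - a.num * (fareyMediant a b).den = 1 ∧
    b.num * (fareyMediant a b).den - (fareyMediant a b).num * b.den = 1 := by
  obtain ⟨h1, h2⟩ := fareyMediant_num_den h
  rw [Rat.lt_iff, Rat.lt_iff, h1, h2]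
  refine ⟨?_, ?_, ?_, ?_⟩ <;> linarith

theorem den_add_den_le {a b x : ℚ} (h : b.num * a.den - a.num * b.den = 1)
    (ha : a < x) (hb : x < b) : a.den + b.den ≤ x.den := by
  rw [Rat.lt_iff] at ha hb
  have h1 : (0 : ℤ) < a.den := by exact_mod_cast a.den_pos
  have h2 : (0 : ℤ) < b.den := by exact_mod_cast b.den_pos
  have e : (x.den : ℤ) = (x.num * a.den - a.num * x.den) * b.den
      + (b.num * x.den - x.num * b.den) * a.den := by linear_combination (-(x.den : ℤ)) * h
  have : (a.den : ℤ) + b.den ≤ x.den := by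
    rw [e]
    nlinarith
  exact_mod_cast this

/-- The descent, with the values `p` and `q` at the end points `a` and `b` included. -/
def springbornOn (n : ℕ) (a b p q x : ℚ) : ℚ :=
  if x = a then p else if x = b then q else springbornDescent n a b p q x

theorem springbornOn_left {n : ℕ} {a b p q x : ℚ} (h : b.num * a.den - a.num * b.den = 1)
    (hn : x.den < n + (a.den + b.den)) (ha : a ≤ x) (hx : x ≤ fareyMediant a b) :
    ∃ k, x.den < k + (a.den + (fareyMediant a b).den) ∧ springbornOn n a b p q x =
      springbornOn k a (fareyMediant a b) p (springbornMediant p q) x := by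
  obtain ⟨m1, m2, -, -⟩ := fareyMediant_between h
  have hd := (fareyMediant_num_den h).2
  have hp := a.den_pos
  rcases eq_or_lt_of_le ha with rfl | ha'
  · exact ⟨a.den, by omega, by simp [springbornOn]⟩
  have hC := den_add_den_le h ha' (hx.trans_lt m2)
  obtain ⟨k, rfl⟩ : ∃ k, n = k + 1 := ⟨n - 1, by omega⟩
  refine ⟨k, by omega, ?_⟩
  have hb : x ≠ b := (hx.trans_lt m2).ne
  rcases eq_or_lt_of_le hx with hx' | hx'
  · simp [springbornOn, springbornDescent, ha'.ne', hb, ← hx']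
  · simp [springbornOn, springbornDescent, ha'.ne', hb, hx', hx'.ne]

theorem springbornOn_right {n : ℕ} {a b p q x : ℚ} (h : b.num * a.den - a.num * b.den = 1)
    (hn : x.den < n + (a.den + b.den)) (hb : x ≤ b) (hx : fareyMediant a b ≤ x) :
    ∃ k, x.den < k + ((fareyMediant a b).den + b.den) ∧ springbornOn n a b p q x =
      springbornOn k (fareyMediant a b) b (springbornMediant p q) q x := by
  obtain ⟨m1, m2, -, -⟩ := fareyMediant_between h
  have hd := (fareyMediant_num_den h).2
  have hp := b.den_pos
  have ha : x ≠ a := (m1.trans_le hx).ne'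
  rcases eq_or_lt_of_le hb with rfl | hb'
  · exact ⟨x.den, by omega, by simp [springbornOn, ha, m2.ne']⟩
  have hC := den_add_den_le h (m1.trans_le hx) hb'
  obtain ⟨k, rfl⟩ : ∃ k, n = k + 1 := ⟨n - 1, by omega⟩
  refine ⟨k, by have := a.den_pos; omega, ?_⟩
  rcases eq_or_lt_of_le hx with hx' | hx'
  · rw [← hx'] at ha hb'
    simp [springbornOn, springbornDescent, ha, hb'.ne, ← hx']
  · simp [springbornOn, springbornDescent, ha, hb'.ne, hx'.not_gt, hx'.ne']

theorem springbornOn_fareyMediant {c d : ℚ} (h' : d.num * c.den - c.num * d.den = 1) (k : ℕ) :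
    ∀ (n₁ n₂ n₃ : ℕ) (a b p q : ℚ), b.num * a.den - a.num * b.den = 1 → a ≤ c → d ≤ b →
      (fareyMediant c d).den < k + (a.den + b.den) →
      c.den < n₁ + (a.den + b.den) → d.den < n₂ + (a.den + b.den) →
      (fareyMediant c d).den < n₃ + (a.den + b.den) →
      springbornOn n₃ a b p q (fareyMediant c d) =
        springbornMediant (springbornOn n₁ a b p q c) (springbornOn n₂ a b p q d) := by
  obtain ⟨l1, l2, -, -⟩ := fareyMediant_between h'
  have hd' := (fareyMediant_num_den h').2
  induction k with
  | zero =>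
    intro n₁ n₂ n₃ a b p q h hac hdb hk
    have := den_add_den_le h (hac.trans_lt l1) (l2.trans_le hdb)
    omega
  | succ k ih =>
    intro n₁ n₂ n₃ a b p q h hac hdb hk h1 h2 h3
    obtain ⟨m1, m2, m3, m4⟩ := fareyMediant_between h
    have hd := (fareyMediant_num_den h).2
    have hap := a.den_pos
    have hbp := b.den_pos
    rcases le_or_gt d (fareyMediant a b) with hdm | hdm
    · obtain ⟨k₁, i1, e1⟩ := springbornOn_left (p := p) (q := q) h h1 hac
        ((l1.trans l2).le.trans hdm)
      obtain ⟨k₂, i2, e2⟩ := springbornOn_left (p := p) (q := q) h h2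
        (hac.trans (l1.trans l2).le) hdm
      obtain ⟨k₃, i3, e3⟩ := springbornOn_left (p := p) (q := q) h h3
        (hac.trans l1.le) (l2.le.trans hdm)
      rw [e1, e2, e3]
      exact ih _ _ _ _ _ _ _ m3 hac hdm (by omega) i1 i2 i3
    rcases le_or_gt (fareyMediant a b) c with hcm | hcm
    · obtain ⟨k₁, i1, e1⟩ := springbornOn_right (p := p) (q := q) h h1
        ((l1.trans l2).le.trans hdb) hcm
      obtain ⟨k₂, i2, e2⟩ := springbornOn_right (p := p) (q := q) h h2 hdb
        (hcm.trans (l1.trans l2).le)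
      obtain ⟨k₃, i3, e3⟩ := springbornOn_right (p := p) (q := q) h h3
        (l2.le.trans hdb) (hcm.trans l1.le)
      rw [e1, e2, e3]
      exact ih _ _ _ _ _ _ _ m4 hcm hdb (by omega) i1 i2 i3
    have hC := den_add_den_le h' hcm hdm
    rcases eq_or_lt_of_le hac with rfl | hac'
    · rcases eq_or_lt_of_le hdb with rfl | hdb'
      · obtain ⟨j, rfl⟩ : ∃ j, n₃ = j + 1 := ⟨n₃ - 1, by omega⟩
        simp [springbornOn, springbornDescent, m1.ne', m2.ne, (m1.trans m2).ne']
      · have := den_add_den_le m4 hdm hdb'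
        omega
    · have := den_add_den_le m3 hac' hcm
      omega

theorem springbornRat_zero : springbornRat 0 = 0 := by simp [springbornRat]

theorem springbornRat_one : springbornRat 1 = 1 / 2 := by simp [springbornRat]

/-- The defining property of the Springborn function: at neighbours `x = a / b` and `y = c / d` in
`[0, 1]`, that is `|a d - b c| = 1`, it intertwines the Farey and the Springborn mediants. -/
theorem springbornRat_fareyMediant {x y : ℚ} (hx : x ∈ Set.Icc 0 1) (hy : y ∈ Set.Icc 0 1)
    (h : |x.num * y.den - y.num * x.den| = 1) :
    springbornRat (fareyMediant x y) = springbornMediant (springbornRat x) (springbornRat y) := by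
  have key : ∀ c d : ℚ, c ∈ Set.Icc 0 1 → d ∈ Set.Icc 0 1 →
      d.num * c.den - c.num * d.den = 1 → springbornRat (fareyMediant c d) =
        springbornMediant (springbornRat c) (springbornRat d) := by
    intro c d hc hd hcd
    exact springbornOn_fareyMediant hcd (fareyMediant c d).den c.den d.den (fareyMediant c d).den
      0 1 0 (1 / 2) (by simp) hc.1 hd.2 (by simp) (by simp) (by simp) (by simp)
  rcases eq_or_eq_neg_of_abs_eq h with h | h
  · have e1 : fareyMediant x y = fareyMediant y x := by simp only [fareyMediant, add_comm]
    have e2 : ∀ u v, springbornMediant u v = springbornMediant v u := by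
      intro u v
      simp only [springbornMediant, add_comm]
    rw [e1, e2]
    exact key y x hy hx h
  · exact key x y hx hy (by linarith)

/-- The Springborn function on the real interval `[0, 1]`: the monotone extension of
`springbornRat`, by the supremum of the values at the rational points of `[0, x]`. -/
noncomputable def springborn (x : ℝ) : ℝ :=
  sSup {y : ℝ | ∃ r : ℚ, 0 ≤ r ∧ r ≤ 1 ∧ (r : ℝ) ≤ x ∧ y = (springbornRat r : ℝ)}

/-!
At Farey neighbours `a < b` the values of the Springborn function are reduced fractions with
denominators `q₁`, `q₂` and determinant `k` such that `(q₁, q₂, k)` is a Markov triple,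
`q₁² + q₂² + k² = 3 q₁ q₂ k`.  The Springborn mediant cancels to a fraction with denominator
`q₃ = 3 q₁ q₂ - k = (q₁² + q₂²) / k`, and the new determinants are `q₂` and `q₁`, so this structure
is inherited along the Farey tree (`SpringbornNeighbours.left`, `SpringbornNeighbours.right`).
As the determinants are positive, the function increases, and a descent in the tree gives
monotonicity on the rational points and hence on the real line (`springborn_monotone`).

By Lebesgue's theorem a monotone function is differentiable almost everywhere, and it remains to see
that the derivative vanishes at every irrational point `x` where it exists.  Over a Farey interval
`[a, b]` with denominators `A`, `B` the slope is `k A B / (q₁ q₂)`, and halving the interval at the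
mediant multiplies it by `(1 + A / B) / (1 + (q₁ / q₂)²)` on the left and by
`(1 + B / A) / (1 + (q₂ / q₁)²)` on the right.  If the descent towards `x` has just turned from right
to left, then `B ≤ 2 A` and `2 q₁ ≤ q₂`, because the Markov numbers grow multiplicatively while
the Farey denominators grow additively.  The two factors are then at least `6 / 5` and at most
`3 / 5` (`slope_left_ge`, `slope_right_le`).  The descent towards an irrational point turns
infinitely often (`exists_balanced_springbornNeighbours`), so the slopes cannot converge to
a nonzero limit (`springborn_hasDerivAt_eq_zero`).
-/

/-! ### Markov triples along the Farey tree -/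

/-- The numerator step.  If `p₁ / q₁` and `p₂ / q₂` have coprime denominators that form a Markov
triple with the determinant `k`, then the Springborn mediant, whose defining fraction has the
denominator `q₁ ^ 2 + q₂ ^ 2 = k * (3 * q₁ * q₂ - k)`, cancels by exactly `k`: its reduced form is
`p₃ / (3 * q₁ * q₂ - k)`, and its determinants with the two parents are `q₂` and `q₁`. -/
theorem exists_markov_num {p₁ q₁ p₂ q₂ k : ℤ} (hk0 : k ≠ 0) (hk : k = p₂ * q₁ - p₁ * q₂)
    (hc : IsCoprime q₁ q₂) (hm : q₁ ^ 2 + q₂ ^ 2 + k ^ 2 = 3 * q₁ * q₂ * k) :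
    ∃ p₃, k * p₃ = p₁ * q₁ + p₂ * q₂ ∧ IsCoprime p₃ (3 * q₁ * q₂ - k) ∧
      p₃ * q₁ - p₁ * (3 * q₁ * q₂ - k) = q₂ ∧ p₂ * (3 * q₁ * q₂ - k) - p₃ * q₂ = q₁ := by
  obtain ⟨u, v, huv⟩ := hc
  -- The quotient `p₃` would satisfy `p₃ q₁ = q₂ + p₁ q₃` and `p₃ q₂ = p₂ q₃ - q₁` with
  -- `q₃ = 3 q₁ q₂ - k`, so the Bézout combination of the two right hand sides is the witness.
  obtain ⟨p₃, hp⟩ : ∃ p₃, k * p₃ = p₁ * q₁ + p₂ * q₂ := by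
    refine ⟨u * (q₂ + p₁ * (3 * q₁ * q₂ - k)) + v * (p₂ * (3 * q₁ * q₂ - k) - q₁), ?_⟩
    linear_combination (p₁ * q₁ + p₂ * q₂) * huv + (u * q₂ - v * q₁) * hk
      - (u * p₁ + v * p₂) * hm
  have h1 : p₃ * q₁ - p₁ * (3 * q₁ * q₂ - k) = q₂ := by
    apply mul_left_cancel₀ hk0
    linear_combination q₁ * hp - q₂ * hk + p₁ * hm
  have h2 : p₂ * (3 * q₁ * q₂ - k) - p₃ * q₂ = q₁ := by
    apply mul_left_cancel₀ hk0
    linear_combination - q₂ * hp - q₁ * hk - p₂ * hm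
  exact ⟨p₃, hp, ⟨v * q₁ - u * q₂, u * p₂ - v * p₁, by linear_combination huv + u * h2 + v * h1⟩,
    h1, h2⟩

/-- The determinant of the reduced fractions `springbornRat a` and `springbornRat b`, that is, their
difference multiplied by both denominators.  At Farey neighbours `a < b` it is the smallest or
middle entry of a Markov triple whose other entries are the two denominators. -/
def markovDet (a b : ℚ) : ℤ :=
  (springbornRat b).num * (springbornRat a).den - (springbornRat a).num * (springbornRat b).den

/-- The pairs of Farey neighbours `a < b` in `[0, 1]` at which the values of the Springborn function
have coprime denominators forming, together with their determinant, a Markov triple.  The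
inequality `le_mul` selects the determinant among the two numbers that complete the denominators
to a Markov triple: it is the smaller one, and `3 q₁ q₂ - k` is the other.  The
predicate holds at `(0, 1)` and passes to both halves of the interval under the Farey mediant. -/
structure SpringbornNeighbours (a b : ℚ) : Prop where
  nonneg : 0 ≤ a
  le_one : b ≤ 1
  det : b.num * a.den - a.num * b.den = 1
  coprime : IsCoprime ((springbornRat a).den : ℤ) (springbornRat b).den
  pos : 0 < markovDet a b
  le_mul : markovDet a b ≤ (springbornRat a).den * (springbornRat b).den
  markov : ((springbornRat a).den : ℤ) ^ 2 + (springbornRat b).den ^ 2 + markovDet a b ^ 2 =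
    3 * (springbornRat a).den * (springbornRat b).den * markovDet a b

theorem springbornNeighbours_zero_one : SpringbornNeighbours 0 1 := by
  have h : ((1 / 2 : ℚ).num = 1) ∧ (1 / 2 : ℚ).den = 2 := by norm_num
  refine ⟨le_rfl, le_rfl, by simp, ?_, ?_, ?_, ?_⟩ <;>
    simp only [markovDet, springbornRat_zero, springbornRat_one, h.1, h.2] <;> norm_num

namespace SpringbornNeighbours

variable {a b : ℚ}

theorem lt (h : SpringbornNeighbours a b) : a < b := by
  have := fareyMediant_between h.det
  exact this.1.trans this.2.1

theorem springbornRat_fareyMediant_num_den (h : SpringbornNeighbours a b) :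
    ((springbornRat (fareyMediant a b)).den : ℤ) =
      3 * (springbornRat a).den * (springbornRat b).den - markovDet a b ∧
    markovDet a (fareyMediant a b) = (springbornRat b).den ∧
    markovDet (fareyMediant a b) b = (springbornRat a).den := by
  have hm : springbornRat (fareyMediant a b) =
      springbornMediant (springbornRat a) (springbornRat b) := by
    refine springbornRat_fareyMediant ⟨h.nonneg, h.lt.le.trans h.le_one⟩
      ⟨h.nonneg.trans h.lt.le, h.le_one⟩ ?_
    rw [abs_sub_comm, h.det, abs_one]
  obtain ⟨p₃, e, c, d₁, d₂⟩ := exists_markov_num h.pos.ne' rfl h.coprime h.markov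
  change markovDet a b * p₃ = _ at e
  change IsCoprime p₃ (_ - markovDet a b) at c
  change p₃ * _ - _ * (_ - markovDet a b) = _ at d₁
  change _ * (_ - markovDet a b) - p₃ * _ = _ at d₂
  have hk := h.pos
  have hq : 0 < 3 * ((springbornRat a).den : ℤ) * (springbornRat b).den - markovDet a b := by
    have := h.le_mul
    nlinarith
  have hr : springbornRat (fareyMediant a b) = (p₃ : ℚ) /
      ((3 * (springbornRat a).den * (springbornRat b).den - markovDet a b : ℤ) : ℚ) := by
    rw [hm, springbornMediant, ← e, show ((springbornRat a).den ^ 2 + (springbornRat b).den ^ 2 : ℤ)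
      = markovDet a b * (3 * (springbornRat a).den * (springbornRat b).den - markovDet a b) by
        linear_combination h.markov, Int.cast_mul, Int.cast_mul,
        mul_div_mul_left _ _ (by exact_mod_cast hk.ne')]
  have hn : (springbornRat (fareyMediant a b)).num = p₃ := by
    rw [hr]
    exact Rat.num_div_eq_of_coprime hq (Int.isCoprime_iff_gcd_eq_one.mp c)
  have hd : ((springbornRat (fareyMediant a b)).den : ℤ) =
      3 * (springbornRat a).den * (springbornRat b).den - markovDet a b := by
    rw [hr]
    exact Rat.den_div_eq_of_coprime hq (Int.isCoprime_iff_gcd_eq_one.mp c)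
  refine ⟨hd, ?_, ?_⟩
  · rw [markovDet, hn, hd, d₁]
  · rw [markovDet, hn, hd, d₂]

theorem two_mul_den_le (h : SpringbornNeighbours a b) :
    2 * (springbornRat a).den * (springbornRat b).den ≤
      (springbornRat (fareyMediant a b)).den := by
  have := h.springbornRat_fareyMediant_num_den.1
  have := h.le_mul
  zify
  linarith

theorem left (h : SpringbornNeighbours a b) : SpringbornNeighbours a (fareyMediant a b) := by
  obtain ⟨e, e₁, -⟩ := h.springbornRat_fareyMediant_num_den
  have hm := fareyMediant_between h.det
  have hp : 0 < (springbornRat a).den := Rat.den_pos _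
  have hq : 0 < (springbornRat b).den := Rat.den_pos _
  refine ⟨h.nonneg, hm.2.1.le.trans h.le_one, hm.2.2.1, ?_, ?_, ?_, ?_⟩
  · have hc := h.coprime
    rw [← IsCoprime.pow_right_iff (m := 2) (by norm_num), show
      ((springbornRat b).den : ℤ) ^ 2 = (springbornRat (fareyMediant a b)).den * markovDet a b
        + (springbornRat a).den * (-(springbornRat a).den) by
      rw [e]; linear_combination h.markov, IsCoprime.add_mul_left_right_iff] at hc
    exact hc.of_mul_right_left
  · rw [e₁]; exact_mod_cast hq
  · rw [e₁]
    have := h.two_mul_den_le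
    exact_mod_cast (show (springbornRat b).den ≤
      (springbornRat a).den * (springbornRat (fareyMediant a b)).den by nlinarith)
  · rw [e₁, e]
    linear_combination h.markov

theorem right (h : SpringbornNeighbours a b) : SpringbornNeighbours (fareyMediant a b) b := by
  obtain ⟨e, -, e₁⟩ := h.springbornRat_fareyMediant_num_den
  have hm := fareyMediant_between h.det
  have hp : 0 < (springbornRat a).den := Rat.den_pos _
  have hq : 0 < (springbornRat b).den := Rat.den_pos _
  refine ⟨h.nonneg.trans hm.1.le, h.le_one, hm.2.2.2, ?_, ?_, ?_, ?_⟩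
  · have hc := h.coprime.symm
    rw [← IsCoprime.pow_right_iff (m := 2) (by norm_num), show
      ((springbornRat a).den : ℤ) ^ 2 = (springbornRat (fareyMediant a b)).den * markovDet a b
        + (springbornRat b).den * (-(springbornRat b).den) by
      rw [e]; linear_combination h.markov, IsCoprime.add_mul_left_right_iff] at hc
    exact hc.of_mul_right_left.symm
  · rw [e₁]; exact_mod_cast hp
  · rw [e₁]
    have := h.two_mul_den_le
    exact_mod_cast (show (springbornRat a).den ≤
      (springbornRat (fareyMediant a b)).den * (springbornRat b).den by nlinarith)
  · rw [e₁, e]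
    linear_combination h.markov

theorem sub_eq (h : SpringbornNeighbours a b) : b - a = 1 / (a.den * b.den) := by
  have ha : (a.den : ℚ) ≠ 0 := by exact_mod_cast a.den_ne_zero
  have hb : (b.den : ℚ) ≠ 0 := by exact_mod_cast b.den_ne_zero
  have hd : (b.num : ℚ) * a.den - a.num * b.den = 1 := by exact_mod_cast h.det
  conv_lhs => rw [← Rat.num_div_den a, ← Rat.num_div_den b]
  field_simp
  linear_combination hd

theorem springbornRat_sub_eq (a b : ℚ) : springbornRat b - springbornRat a =
    markovDet a b / ((springbornRat a).den * (springbornRat b).den) := by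
  have ha : ((springbornRat a).den : ℚ) ≠ 0 := by exact_mod_cast Rat.den_ne_zero _
  have hb : ((springbornRat b).den : ℚ) ≠ 0 := by exact_mod_cast Rat.den_ne_zero _
  conv_lhs => rw [← Rat.num_div_den (springbornRat a), ← Rat.num_div_den (springbornRat b)]
  rw [markovDet]
  push_cast
  field_simp

theorem springbornRat_lt (h : SpringbornNeighbours a b) : springbornRat a < springbornRat b := by
  have ha : (0 : ℚ) < (springbornRat a).den := by exact_mod_cast Rat.den_pos _
  have hb : (0 : ℚ) < (springbornRat b).den := by exact_mod_cast Rat.den_pos _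
  have hk : (0 : ℚ) < markovDet a b := by exact_mod_cast h.pos
  rw [← sub_pos, springbornRat_sub_eq]
  positivity

/-! ### Monotonicity at rational points -/

theorem springbornRat_mem (h : SpringbornNeighbours a b) {x : ℚ} (ha : a ≤ x) (hb : x ≤ b) :
    springbornRat x ∈ Set.Icc (springbornRat a) (springbornRat b) := by
  induction hn : x.den - (a.den + b.den) using Nat.strong_induction_on generalizing a b with
  | _ n ih =>
  rcases eq_or_lt_of_le ha with rfl | ha'
  · exact ⟨le_rfl, h.springbornRat_lt.le⟩
  rcases eq_or_lt_of_le hb with rfl | hb'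
  · exact ⟨h.springbornRat_lt.le, le_rfl⟩
  have hle := den_add_den_le h.det ha' hb'
  have hd := (fareyMediant_num_den h.det).2
  have hap := a.den_pos
  have hbp := b.den_pos
  rcases lt_trichotomy x (fareyMediant a b) with hx | rfl | hx
  · have hle' := den_add_den_le h.left.det ha' hx
    have := ih _ (by omega) h.left ha hx.le rfl
    exact ⟨this.1, this.2.trans h.right.springbornRat_lt.le⟩
  · exact ⟨h.left.springbornRat_lt.le, h.right.springbornRat_lt.le⟩
  · have hle' := den_add_den_le h.right.det hx hb'
    have := ih _ (by omega) h.right hx.le hb rfl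
    exact ⟨h.left.springbornRat_lt.le.trans this.1, this.2⟩

theorem springbornRat_mono (h : SpringbornNeighbours a b) {x y : ℚ} (ha : a ≤ x) (hxy : x ≤ y)
    (hb : y ≤ b) : springbornRat x ≤ springbornRat y := by
  induction hn : x.den - (a.den + b.den) using Nat.strong_induction_on generalizing a b with
  | _ n ih =>
  rcases eq_or_lt_of_le ha with rfl | ha'
  · exact (h.springbornRat_mem hxy hb).1
  rcases eq_or_lt_of_le (hxy.trans hb) with rfl | hb'
  · rw [le_antisymm hb hxy]
  have hle := den_add_den_le h.det ha' hb'
  have hd := (fareyMediant_num_den h.det).2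
  have hap := a.den_pos
  have hbp := b.den_pos
  rcases le_or_gt x (fareyMediant a b) with hx | hx
  · rcases le_or_gt y (fareyMediant a b) with hy | hy
    · rcases eq_or_lt_of_le hx with hx' | hx'
      · rw [le_antisymm (hy.trans hx'.ge) hxy]
      have hle' := den_add_den_le h.left.det ha' hx'
      exact ih _ (by omega) h.left ha hy rfl
    · exact (h.left.springbornRat_mem ha hx).2.trans (h.right.springbornRat_mem hy.le hb).1
  · have hle' := den_add_den_le h.right.det hx hb'
    exact ih _ (by omega) h.right hx.le hb rfl

/-! ### Slopes over Farey intervals -/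

theorem markovDet_mul_den (h : SpringbornNeighbours a b) :
    (markovDet a b : ℚ) * (springbornRat (fareyMediant a b)).den =
      ((springbornRat a).den : ℚ) ^ 2 + ((springbornRat b).den : ℚ) ^ 2 := by
  have : markovDet a b * (springbornRat (fareyMediant a b)).den =
      ((springbornRat a).den : ℤ) ^ 2 + (springbornRat b).den ^ 2 := by
    rw [h.springbornRat_fareyMediant_num_den.1]
    linear_combination - h.markov
  exact_mod_cast this

theorem slope_eq (h : SpringbornNeighbours a b) : slope springbornRat a b =
    markovDet a b * (a.den * b.den) / ((springbornRat a).den * (springbornRat b).den) := by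
  rw [slope_def_field, h.sub_eq, springbornRat_sub_eq, div_div_div_eq, mul_one]

/-- Passing to the left half multiplies the slope by `(1 + A / B) / (1 + (q₁ / q₂) ^ 2)`, where
`A`, `B` are the denominators of `a`, `b` and `q₁`, `q₂` those of their values. -/
theorem slope_left_ge (h : SpringbornNeighbours a b) (hB : b.den ≤ 2 * a.den)
    (hq : 2 * (springbornRat a).den ≤ (springbornRat b).den) :
    6 / 5 * slope springbornRat a b ≤ slope springbornRat a (fareyMediant a b) := by
  have hm := h.markovDet_mul_den
  have hd : ((fareyMediant a b).den : ℚ) = a.den + b.den := by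
    exact_mod_cast (fareyMediant_num_den h.det).2
  rw [h.slope_eq, h.left.slope_eq, h.springbornRat_fareyMediant_num_den.2.1, hd, Int.cast_natCast]
  have ha : (0 : ℚ) < (springbornRat a).den := by exact_mod_cast Rat.den_pos _
  have hb : (0 : ℚ) < (springbornRat b).den := by exact_mod_cast Rat.den_pos _
  have hc : (0 : ℚ) < (springbornRat (fareyMediant a b)).den := by exact_mod_cast Rat.den_pos _
  have hA : (0 : ℚ) < a.den := by exact_mod_cast Rat.den_pos _
  have hB' : (0 : ℚ) < b.den := by exact_mod_cast Rat.den_pos _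
  have hBq : (b.den : ℚ) ≤ 2 * a.den := by exact_mod_cast hB
  have hqq : 2 * ((springbornRat a).den : ℚ) ≤ (springbornRat b).den := by exact_mod_cast hq
  generalize ((springbornRat a).den : ℚ) = q₁ at *
  generalize ((springbornRat b).den : ℚ) = q₂ at *
  generalize ((springbornRat (fareyMediant a b)).den : ℚ) = q₃ at *
  generalize (a.den : ℚ) = A at *
  generalize (b.den : ℚ) = B at *
  generalize (markovDet a b : ℚ) = k at *
  have key : 6 * (k * q₃) * B ≤ 5 * q₂ ^ 2 * (A + B) := by
    have : 4 * q₁ ^ 2 ≤ q₂ ^ 2 := by nlinarith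
    nlinarith [mul_le_mul_of_nonneg_right this hB'.le,
      mul_le_mul_of_nonneg_left hBq (sq_nonneg q₂)]
  rw [← mul_div_assoc, div_le_div_iff₀ (by positivity) (by positivity)]
  calc _ = (6 * (k * q₃) * B) * (q₁ * A / 5) := by ring
    _ ≤ (5 * q₂ ^ 2 * (A + B)) * (q₁ * A / 5) := by gcongr
    _ = _ := by ring

/-- Passing to the right half multiplies the slope by `(1 + B / A) / (1 + (q₂ / q₁) ^ 2)`, where
`A`, `B` are the denominators of `a`, `b` and `q₁`, `q₂` those of their values. -/
theorem slope_right_le (h : SpringbornNeighbours a b) (hB : b.den ≤ 2 * a.den)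
    (hq : 2 * (springbornRat a).den ≤ (springbornRat b).den) :
    slope springbornRat (fareyMediant a b) b ≤ 3 / 5 * slope springbornRat a b := by
  have hm := h.markovDet_mul_den
  have hd : ((fareyMediant a b).den : ℚ) = a.den + b.den := by
    exact_mod_cast (fareyMediant_num_den h.det).2
  rw [h.slope_eq, h.right.slope_eq, h.springbornRat_fareyMediant_num_den.2.2, hd, Int.cast_natCast]
  have ha : (0 : ℚ) < (springbornRat a).den := by exact_mod_cast Rat.den_pos _
  have hb : (0 : ℚ) < (springbornRat b).den := by exact_mod_cast Rat.den_pos _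
  have hc : (0 : ℚ) < (springbornRat (fareyMediant a b)).den := by exact_mod_cast Rat.den_pos _
  have hA : (0 : ℚ) < a.den := by exact_mod_cast Rat.den_pos _
  have hB' : (0 : ℚ) < b.den := by exact_mod_cast Rat.den_pos _
  have hBq : (b.den : ℚ) ≤ 2 * a.den := by exact_mod_cast hB
  have hqq : 2 * ((springbornRat a).den : ℚ) ≤ (springbornRat b).den := by exact_mod_cast hq
  generalize ((springbornRat a).den : ℚ) = q₁ at *
  generalize ((springbornRat b).den : ℚ) = q₂ at *
  generalize ((springbornRat (fareyMediant a b)).den : ℚ) = q₃ at *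
  generalize (a.den : ℚ) = A at *
  generalize (b.den : ℚ) = B at *
  generalize (markovDet a b : ℚ) = k at *
  have key : 5 * q₁ ^ 2 * (A + B) ≤ 3 * (k * q₃) * A := by
    have : 4 * q₁ ^ 2 ≤ q₂ ^ 2 := by nlinarith
    nlinarith [mul_le_mul_of_nonneg_right this hA.le,
      mul_le_mul_of_nonneg_left hBq (sq_nonneg q₁)]
  rw [← mul_div_assoc, div_le_div_iff₀ (by positivity) (by positivity)]
  calc _ = (5 * q₁ ^ 2 * (A + B)) * (q₂ * B / 5) := by ring
    _ ≤ (3 * (k * q₃) * A) * (q₂ * B / 5) := by gcongr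
    _ = _ := by ring

/-! ### Farey intervals around an irrational point -/

theorem cast_sub_le (h : SpringbornNeighbours a b) :
    (b : ℝ) - a ≤ 1 / a.den ∧ (b : ℝ) - a ≤ 1 / b.den := by
  have hs : (b : ℝ) - a = 1 / (a.den * b.den) := by
    rw [← Rat.cast_sub, h.sub_eq]
    push_cast
    rfl
  have hA : (1 : ℝ) ≤ a.den := by exact_mod_cast a.den_pos
  have hB : (1 : ℝ) ≤ b.den := by exact_mod_cast b.den_pos
  rw [hs]
  exact ⟨one_div_le_one_div_of_le (by linarith) (by nlinarith),
    one_div_le_one_div_of_le (by linarith) (by nlinarith)⟩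

/-- From an interval around an irrational point `x`, finitely many passages to the left half lead
to an interval with `x` in its right half: these passages fix `a` and increase the denominator of
`b`, which is less than `1 / (x - a)`. -/
theorem exists_fareyMediant_lt {x : ℝ} (hx : Irrational x) (h : SpringbornNeighbours a b)
    (ha : a < x) (hb : x < b) :
    ∃ b', SpringbornNeighbours a b' ∧ x < b' ∧ fareyMediant a b' < x := by
  obtain ⟨N, hN⟩ := exists_nat_one_div_lt (sub_pos.mpr ha)
  induction hn : N + 1 - b.den using Nat.strong_induction_on generalizing b with
  | _ n ih =>
  rcases lt_or_gt_of_ne (hx.ne_rat (fareyMediant a b)) with hm | hm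
  · refine ih _ ?_ h.left hm rfl
    have hd := (fareyMediant_num_den h.det).2
    have hA := a.den_pos
    have h1 : 1 / ((N : ℝ) + 1) < 1 / b.den := by linarith [h.cast_sub_le.2]
    have h2 : (b.den : ℝ) < N + 1 := lt_of_one_div_lt_one_div (by positivity) h1
    have : b.den < N + 1 := by exact_mod_cast h2
    omega
  · exact ⟨b, h, hb, hm⟩

/-- The mirror image of `exists_fareyMediant_lt`. -/
theorem exists_lt_fareyMediant {x : ℝ} (hx : Irrational x) (h : SpringbornNeighbours a b)
    (ha : a < x) (hb : x < b) :
    ∃ a', SpringbornNeighbours a' b ∧ a' < x ∧ x < fareyMediant a' b ∧ a.den ≤ a'.den := by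
  obtain ⟨N, hN⟩ := exists_nat_one_div_lt (sub_pos.mpr hb)
  induction hn : N + 1 - a.den using Nat.strong_induction_on generalizing a with
  | _ n ih =>
  rcases lt_or_gt_of_ne (hx.ne_rat (fareyMediant a b)) with hm | hm
  · exact ⟨a, h, ha, hm, le_rfl⟩
  · have hd := (fareyMediant_num_den h.det).2
    have hB := b.den_pos
    have h1 : 1 / ((N : ℝ) + 1) < 1 / a.den := by linarith [h.cast_sub_le.1]
    have h2 : (a.den : ℝ) < N + 1 := lt_of_one_div_lt_one_div (by positivity) h1
    have h3 : a.den < N + 1 := by exact_mod_cast h2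
    obtain ⟨a', i1, i2, i3, i4⟩ := ih _ (by omega) h.right hm rfl
    exact ⟨a', i1, i2, i3, by omega⟩

end SpringbornNeighbours

/-- Around an irrational point there are arbitrarily small Farey intervals at which
`slope_left_ge` and `slope_right_le` apply: those that arise by passing to a right half and then
to a left half. -/
theorem exists_balanced_springbornNeighbours {x : ℝ} (hx : Irrational x) (h0 : 0 < x)
    (h1 : x < 1) (N : ℕ) :
    ∃ a b : ℚ, SpringbornNeighbours a b ∧ (a : ℝ) < x ∧ x < b ∧ N < a.den ∧
      b.den ≤ 2 * a.den ∧ 2 * (springbornRat a).den ≤ (springbornRat b).den := by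
  have step : ∀ {a b : ℚ}, SpringbornNeighbours a b → (a : ℝ) < x → x < b →
      ∃ a' b' : ℚ, SpringbornNeighbours a' b' ∧ (a' : ℝ) < x ∧ x < b' ∧ a.den < a'.den ∧
        b'.den ≤ 2 * a'.den ∧ 2 * (springbornRat a').den ≤ (springbornRat b').den := by
    intro a b h ha hb
    obtain ⟨c, hc, hxc, hmx⟩ := h.exists_fareyMediant_lt hx ha hb
    obtain ⟨d, hd, hdx, hxm, hden⟩ := hc.right.exists_lt_fareyMediant hx hmx hxc
    have e1 := (fareyMediant_num_den hc.det).2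
    have e2 := (fareyMediant_num_den hd.det).2
    have hcp := c.den_pos
    -- In `(d, c)`, reached through right halves, `c` has the smaller denominator; so the mediant
    -- of `d` and `c` has at most twice the denominator of `d`.
    refine ⟨d, _, hd.left, hdx, hxm, by omega, by have := a.den_pos; omega, ?_⟩
    have := hd.two_mul_den_le
    have : 0 < (springbornRat c).den := Rat.den_pos _
    nlinarith
  induction N with
  | zero =>
    obtain ⟨a, b, i1, i2, i3, i4, i5⟩ := step springbornNeighbours_zero_one (by simpa) (by simpa)
    exact ⟨a, b, i1, i2, i3, a.den_pos, i5⟩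
  | succ N ih =>
    obtain ⟨a, b, i1, i2, i3, i4, -⟩ := ih
    obtain ⟨a', b', j1, j2, j3, j4, j5⟩ := step i1 i2 i3
    exact ⟨a', b', j1, j2, j3, by omega, j5⟩

/-! ### The extended function -/

theorem springbornRat_mono {x y : ℚ} (hx : 0 ≤ x) (hxy : x ≤ y) (hy : y ≤ 1) :
    springbornRat x ≤ springbornRat y :=
  springbornNeighbours_zero_one.springbornRat_mono hx hxy hy

theorem springborn_ratCast {r : ℚ} (h0 : 0 ≤ r) (h1 : r ≤ 1) :
    springborn (r : ℝ) = (springbornRat r : ℝ) := by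
  refine IsGreatest.csSup_eq ⟨⟨r, h0, h1, le_rfl, rfl⟩, ?_⟩
  rintro _ ⟨s, hs0, -, hsr, rfl⟩
  exact_mod_cast springbornRat_mono hs0 (by exact_mod_cast hsr) h1

/-- Monotonicity holds on all of `ℝ`, since `springborn` takes the junk value `sSup ∅ = 0` on the
negative numbers. -/
theorem springborn_monotone : Monotone springborn := by
  intro x y hxy
  have hbdd : BddAbove {z : ℝ | ∃ r : ℚ, 0 ≤ r ∧ r ≤ 1 ∧ (r : ℝ) ≤ y ∧
      z = (springbornRat r : ℝ)} := by
    refine ⟨springbornRat 1, ?_⟩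
    rintro _ ⟨r, h0, h1, -, rfl⟩
    exact_mod_cast springbornRat_mono h0 h1 le_rfl
  have hnonneg : 0 ≤ springborn y := by
    refine Real.sSup_nonneg ?_
    rintro _ ⟨r, h0, h1, -, rfl⟩
    have := springbornRat_mono le_rfl h0 h1
    rw [springbornRat_zero] at this
    exact_mod_cast this
  refine Real.sSup_le ?_ hnonneg
  rintro _ ⟨r, h0, h1, hr, rfl⟩
  exact le_csSup hbdd ⟨r, h0, h1, hr.trans hxy, rfl⟩

/-- The derivative at `x` is approximated by the slopes over all small intervals around `x`. -/
theorem HasDerivAt.exists_abs_slope_sub_le {f : ℝ → ℝ} {d x ε : ℝ} (h : HasDerivAt f d x)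
    (hε : 0 < ε) : ∃ δ > 0, ∀ a b, a < x → x < b → b - a < δ → |slope f a b - d| ≤ ε := by
  obtain ⟨δ, hδ, H⟩ := Metric.eventually_nhds_iff.mp
    ((hasDerivAt_iff_isLittleO.mp h).def hε)
  refine ⟨δ, hδ, fun a b ha hb hab ↦ ?_⟩
  have Ha := H (y := a) (by rw [Real.dist_eq, abs_lt]; constructor <;> linarith)
  have Hb := H (y := b) (by rw [Real.dist_eq, abs_lt]; constructor <;> linarith)
  rw [Real.norm_eq_abs, Real.norm_eq_abs, abs_of_neg (by linarith : a - x < 0), smul_eq_mul,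
    abs_le] at Ha
  rw [Real.norm_eq_abs, Real.norm_eq_abs, abs_of_pos (by linarith : 0 < b - x), smul_eq_mul,
    abs_le] at Hb
  have hw : 0 < b - a := by linarith
  rw [slope_def_field, div_sub' hw.ne', abs_div, abs_of_pos hw, div_le_iff₀ hw, abs_le]
  constructor <;> linarith [Ha.1, Ha.2, Hb.1, Hb.2]

theorem slope_springborn_ratCast {a b : ℚ} (ha : a ∈ Set.Icc 0 1) (hb : b ∈ Set.Icc 0 1) :
    slope springborn (a : ℝ) b = (slope springbornRat a b : ℚ) := by
  rw [slope_def_field, slope_def_field, springborn_ratCast ha.1 ha.2,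
    springborn_ratCast hb.1 hb.2]
  push_cast
  rfl

/-- The slopes over small Farey intervals around `x` are close to `d`, but the slope over a
balanced one and the slope over its half that contains `x` differ by a factor outside
`(3 / 5, 6 / 5)`. -/
theorem springborn_hasDerivAt_eq_zero {x d : ℝ} (hx : Irrational x) (h0 : 0 < x) (h1 : x < 1)
    (h : HasDerivAt springborn d x) : d = 0 := by
  by_contra hd
  have hd' : 0 < |d| := abs_pos.mpr hd
  obtain ⟨δ, hδ, H⟩ := h.exists_abs_slope_sub_le (ε := |d| / 20) (by positivity)
  obtain ⟨N, hN⟩ := exists_nat_one_div_lt hδ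
  obtain ⟨a, b, hab, hax, hxb, hden, hB, hq⟩ := exists_balanced_springbornNeighbours hx h0 h1 N
  have hw : (b : ℝ) - a < δ := by
    have hA : ((N : ℝ) + 1) ≤ a.den := by exact_mod_cast hden
    exact hab.cast_sub_le.1.trans_lt
      ((one_div_le_one_div_of_le (by positivity) hA).trans_lt hN)
  obtain ⟨m1, m2, -, -⟩ := fareyMediant_between hab.det
  have m1' : (a : ℝ) < fareyMediant a b := by exact_mod_cast m1
  have m2' : (fareyMediant a b : ℝ) < b := by exact_mod_cast m2
  have ia : a ∈ Set.Icc 0 1 := ⟨hab.nonneg, hab.lt.le.trans hab.le_one⟩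
  have ib : b ∈ Set.Icc 0 1 := ⟨hab.nonneg.trans hab.lt.le, hab.le_one⟩
  have im : fareyMediant a b ∈ Set.Icc 0 1 := ⟨ia.1.trans m1.le, m2.le.trans ib.2⟩
  -- Monotonicity excludes `d < 0`.
  have hS := H a b hax hxb hw
  have hpos : 0 ≤ slope springborn (a : ℝ) b := by
    rw [slope_def_field]
    exact div_nonneg (sub_nonneg.mpr (springborn_monotone (by linarith))) (by linarith)
  rw [abs_le] at hS
  have hdpos : 0 < d := by
    by_contra hneg
    rw [abs_of_nonpos (not_lt.mp hneg)] at hS hd'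
    linarith [hS.2]
  rw [abs_of_pos hdpos] at hS H
  rcases lt_or_gt_of_ne (hx.ne_rat (fareyMediant a b)) with hm | hm
  · have hS' := abs_le.mp (H a (fareyMediant a b) hax hm (by linarith))
    have hj : 6 / 5 * slope springborn (a : ℝ) b ≤ slope springborn a (fareyMediant a b) := by
      rw [slope_springborn_ratCast ia ib, slope_springborn_ratCast ia im]
      have := (Rat.cast_le (K := ℝ)).mpr (hab.slope_left_ge hB hq)
      push_cast at this
      exact this
    linarith [hS.1, hS'.2]
  · have hS' := abs_le.mp (H (fareyMediant a b) b hm hxb (by linarith))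
    have hj : slope springborn (fareyMediant a b : ℝ) b ≤ 3 / 5 * slope springborn (a : ℝ) b := by
      rw [slope_springborn_ratCast ia ib, slope_springborn_ratCast im ib]
      have := (Rat.cast_le (K := ℝ)).mpr (hab.slope_right_le hB hq)
      push_cast at this
      exact this
    linarith [hS.2, hS'.1]

theorem corollary4p2 :
    (∀ r : ℚ, 0 ≤ r → r ≤ 1 → springborn (r : ℝ) = (springbornRat r : ℝ)) ∧
    MonotoneOn springborn (Set.Icc 0 1) ∧
    ∀ᵐ x ∂(MeasureTheory.volume : MeasureTheory.Measure ℝ),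
      x ∈ Set.Icc (0 : ℝ) 1 → HasDerivAt springborn 0 x := by
  refine ⟨fun r ↦ springborn_ratCast, springborn_monotone.monotoneOn _, ?_⟩
  have hirr : ∀ᵐ x : ℝ, Irrational x :=
    MeasureTheory.compl_mem_ae_iff.mpr ((Set.countable_range ((↑) : ℚ → ℝ)).measure_zero _)
  filter_upwards [hirr, springborn_monotone.ae_differentiableAt] with x hx hdiff hmem
  have h := hdiff.hasDerivAt
  rwa [springborn_hasDerivAt_eq_zero hx (lt_of_le_of_ne hmem.1 hx.ne_zero.symm)
    (lt_of_le_of_ne hmem.2 hx.ne_one) h] at h
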